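/- Let $k$ be a field and let $H$ be a Hopf algebra over $k$ with bijective antipode $S$; write $\Delta(h)=h_{(1)}\otimes h_{(2)}$ for its coproduct and $\varepsilon$ for its counit. Let $A$ be a right $H$-comodule algebra, that is, a unital $k$-algebra with a coassociative and counital right coaction $\rho\colon A\to A\otimes H$, $\rho(a)=a_{(0)}\otimes a_{(1)}$, which is a unital algebra map, and let $B=\{a\in A:\rho(a)=a\otimes 1\}$ be its subalgebra of coinvariants. Assume that $A(B)^H$ is a Hopf Galois extension, i.e. that the canonical map $$\mathrm{can}\colon A\otimes_B A\to A\otimes H,\qquad a\otimes a'\mapsto a\,a'_{(0)}\otimes a'_{(1)},$$ is bijective, and that it is cleft by a convolution-invertible total integral $f\colon H\to A$: $f$ is $k$-linear, $f(1)=1$, $f(h)_{(0)}\otimes f(h)_{(1)}=f(h_{(1)})\otimes h_{(2)}$ for all $h\in H$, and there is a $k$-linear map $f^{-1}\colon H\to A$ with $f(h_{(1)})f^{-1}(h_{(2)})=\varepsilon(h)1=f^{-1}(h_{(1)})f(h_{(2)})$ for all $h\in H$. Let $[A,B]$ be the $k$-linear span of all $ab-ba$ with $a\in A$, $b\in B$,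 let $A_B=A/[A,B]$ be the quotient vector space, and write $\bar a$ for the class of $a\in A$. Then $$h\cdot\bar a=\overline{f(h_{(2)})\,a\,f^{-1}(h_{(1)})},\qquad \bar\rho(\bar a)=\overline{a_{(0)}}\otimes a_{(1)}$$ are well defined and make $A_B$ a left-right stable anti Yetter–Drinfeld module over $H$. That is, the first formula is a unital associative left $H$-action, the second is a coassociative counital right $H$-coaction, and, writing $\bar\rho(m)=m_{(0)}\otimes m_{(1)}$, for all $h\in H$ and $m\in A_B$ $$\bar\rho(h\cdot m)=h_{(2)}\cdot m_{(0)}\otimes h_{(3)}\,m_{(1)}\,S(h_{(1)})\qquad\text{and}\qquad m_{(1)}\cdot m_{(0)}=m .$$ -/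

import Mathlib

open scoped TensorProduct

noncomputable section

namespace HopfGalois

section Coactions

variable {k H M : Type*} [Field k] [Ring H] [HopfAlgebra k H] [AddCommGroup M] [Module k M]

/-- `ρ : M → M ⊗ H` is a (coassociative, counital) right `H`-comodule structure on `M`. -/
structure IsRightCoaction (ρ : M →ₗ[k] M ⊗[k] H) : Prop where
  coassoc : (TensorProduct.assoc k M H H).toLinearMap ∘ₗ ρ.rTensor H ∘ₗ ρ =
    (Coalgebra.comul (R := k) (A := H)).lTensor M ∘ₗ ρ
  counit : (TensorProduct.rid k M).toLinearMap ∘ₗ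
    (Coalgebra.counit (R := k) (A := H)).lTensor M ∘ₗ ρ = LinearMap.id

/-- For a left `H`-module structure `act` on `M`, the trilinear map sending `x ⊗ y ⊗ z` to the
operator `m ⊗ t ↦ (y · m) ⊗ z t S(x)` on `M ⊗ H`. -/
def aydOperator (act : H →ₐ[k] Module.End k M) :
    H ⊗[k] (H ⊗[k] H) →ₗ[k] Module.End k (M ⊗[k] H) :=
  TensorProduct.homTensorHomMap (.id k) M H M H ∘ₗ
    TensorProduct.map act.toLinearMap
      (TensorProduct.lift ((LinearMap.mul k (Module.End k H)).compl₁₂ (LinearMap.mul k H)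
        ((LinearMap.mul k H).flip ∘ₗ HopfAlgebra.antipode k))) ∘ₗ
    (TensorProduct.assoc k H H H).toLinearMap ∘ₗ (TensorProduct.comm k H (H ⊗[k] H)).toLinearMap

theorem aydOperator_tmul (act : H →ₐ[k] Module.End k M) (x y z t : H) (m : M) :
    aydOperator act (x ⊗ₜ (y ⊗ₜ z)) (m ⊗ₜ t) =
      act y m ⊗ₜ[k] (z * t * HopfAlgebra.antipode k x) := by
  simp [aydOperator, mul_assoc]

/-- `M`, with left `H`-action `act` (given as a unital algebra map `H → End(M)`) and right
`H`-coaction `ρ`, is a left-right stable anti Yetter-Drinfeld module: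
* `ρ (h m) = h₍₂₎ m₍₀₎ ⊗ h₍₃₎ m₍₁₎ S(h₍₁₎)`;
* `m₍₁₎ m₍₀₎ = m`. -/
structure IsLeftRightSAYD (act : H →ₐ[k] Module.End k M) (ρ : M →ₗ[k] M ⊗[k] H) : Prop where
  coaction : IsRightCoaction ρ
  antiYetterDrinfeld : ∀ (h : H) (m : M),
    ρ (act h m) = aydOperator act
      ((Coalgebra.comul (R := k) (A := H)).lTensor H (Coalgebra.comul (R := k) h)) (ρ m)
  stable : ∀ m : M, TensorProduct.lift act.toLinearMap.flip (ρ m) = m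

end Coactions

section Extensions

variable {k H A : Type*} [Field k] [Ring H] [HopfAlgebra k H] [Ring A] [Algebra k A]

/-- The subalgebra `B = {a | ρ a = a ⊗ 1}` of coinvariants of a comodule algebra. -/
def coinvariants (ρ : A →ₐ[k] A ⊗[k] H) : Subalgebra k A :=
  AlgHom.equalizer ρ Algebra.TensorProduct.includeLeft

theorem mem_coinvariants (ρ : A →ₐ[k] A ⊗[k] H) (a : A) :
    a ∈ coinvariants ρ ↔ ρ a = a ⊗ₜ[k] 1 := Iff.rfl

/-- The `k`-subspace of `A ⊗ A` spanned by all `ab ⊗ a' - a ⊗ ba'` with `b ∈ B`. -/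
def balancingRelations (B : Subalgebra k A) : Submodule k (A ⊗[k] A) :=
  Submodule.span k {t | ∃ a a' : A, ∃ b ∈ B, t = (a * b) ⊗ₜ[k] a' - a ⊗ₜ[k] (b * a')}

/-- The tensor product `A ⊗_B A` over a (not necessarily commutative) subalgebra `B` of `A`. -/
abbrev BalancedTensor (B : Subalgebra k A) : Type _ := (A ⊗[k] A) ⧸ balancingRelations B

/-- The map `A ⊗ A → A ⊗ H`, `a ⊗ a' ↦ a a'₍₀₎ ⊗ a'₍₁₎`. -/
def preCan (ρ : A →ₐ[k] A ⊗[k] H) : A ⊗[k] A →ₗ[k] A ⊗[k] H :=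
  TensorProduct.lift ((LinearMap.mul k (A ⊗[k] H)).compl₁₂
    (Algebra.TensorProduct.includeLeft : A →ₐ[k] A ⊗[k] H).toLinearMap ρ.toLinearMap)

theorem preCan_tmul (ρ : A →ₐ[k] A ⊗[k] H) (a a' : A) :
    preCan ρ (a ⊗ₜ a') = (a ⊗ₜ[k] 1) * ρ a' := by
  simp [preCan]

theorem balancingRelations_le_ker (ρ : A →ₐ[k] A ⊗[k] H) :
    balancingRelations (coinvariants ρ) ≤ LinearMap.ker (preCan ρ) := by
  refine Submodule.span_le.2 ?_
  rintro _ ⟨a, a', b, hb, rfl⟩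
  have hb' := (mem_coinvariants ρ b).1 hb
  simp [preCan_tmul, hb', ← mul_assoc]

/-- The canonical map `can : A ⊗_B A → A ⊗ H`, `a ⊗ a' ↦ a a'₍₀₎ ⊗ a'₍₁₎`,
where `B` is the subalgebra of coinvariants. -/
def can (ρ : A →ₐ[k] A ⊗[k] H) : BalancedTensor (coinvariants ρ) →ₗ[k] A ⊗[k] H :=
  (balancingRelations (coinvariants ρ)).liftQ (preCan ρ) (balancingRelations_le_ker ρ)

/-- The algebra map `ρ : A → A ⊗ H` makes `A` a right `H`-comodule algebra, and the extension
`B ⊆ A` of its coinvariants is Hopf Galois. -/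
structure IsHopfGaloisExtension (ρ : A →ₐ[k] A ⊗[k] H) : Prop where
  coaction : IsRightCoaction ρ.toLinearMap
  can_bijective : Function.Bijective (can ρ)

/-- `f : H → A` is a total integral: a unital map of right `H`-comodules. -/
structure IsTotalIntegral (ρ : A →ₐ[k] A ⊗[k] H) (f : H →ₗ[k] A) : Prop where
  unital : f 1 = 1
  colinear : ρ.toLinearMap ∘ₗ f = f.rTensor H ∘ₗ Coalgebra.comul

/-- `g` is the two-sided inverse of `f` in the convolution algebra `Hom(H, A)`. -/
structure IsConvolutionInverse (f g : H →ₗ[k] A) : Prop where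
  mul_inv : WithConv.toConv f * WithConv.toConv g = 1
  inv_mul : WithConv.toConv g * WithConv.toConv f = 1

/-- The `k`-subspace `[A, B]` of `A` spanned by all commutators `ab - ba` with `b ∈ B`. -/
def commutatorSubspace (B : Subalgebra k A) : Submodule k A :=
  Submodule.span k {c | ∃ a : A, ∃ b ∈ B, c = a * b - b * a}

/-- The quotient space `A_B = A / [A, B]`. -/
abbrev CommutatorQuotient (B : Subalgebra k A) : Type _ := A ⧸ commutatorSubspace B

/-- The element `f(h₍₂₎) a g(h₍₁₎)` of `A`. -/
def cleftAction (f g : H →ₗ[k] A) (h : H) (a : A) : A :=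
  TensorProduct.lift ((LinearMap.mul k A).flip.compl₁₂ (LinearMap.mulLeft k a ∘ₗ g) f)
    (Coalgebra.comul (R := k) h)

theorem cleftAction_eq_sum (f g : H →ₗ[k] A) (h : H) (a : A) {ι : Type*}
    (r : Coalgebra.Repr k h ι) :
    cleftAction f g h a = ∑ i ∈ r.index, f (r.right i) * a * g (r.left i) := by
  simp [cleftAction, ← r.eq, mul_assoc]

end Extensions

end HopfGalois

end

namespace HopfGalois

open LinearMap Coalgebra WithConv

/-! ### Convolution identities for the integral and its inverse -/

section Convolution

variable {k H A : Type*} [Field k] [Ring H] [HopfAlgebra k H] [Ring A] [Algebra k A]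

/-! Let `l ⊗ r` act on `A` by `a ↦ r a l`. Modulo `[A, B]` this depends only on the class of `l ⊗ r`
in `A ⊗_B A`, hence, by injectivity of `can`, only on its image in `A ⊗ H` (`mkQ_sandwich_congr`).
The action of `h` is the operator of `g(h₍₁₎) ⊗ f(h₍₂₎)`, a lift of `1 ⊗ h` (`preCan_map_comul`).
Descent to `A_B`, unit, multiplicativity and stability thus reduce to comparing two elements with
the same image in `A ⊗ H`.

The anti Yetter-Drinfeld condition is instead a direct computation: apply the algebra map `ρ` to
`f(h₍₂₎) a g(h₍₁₎)` and use `coaction_inverse`. -/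

theorem algHom_comp_mul_eq_one {D : Type*} [Ring D] [Algebra k D] (φ : A →ₐ[k] D)
    {u v : H →ₗ[k] A} (h : toConv u * toConv v = 1) :
    toConv (φ.toLinearMap ∘ₗ u) * toConv (φ.toLinearMap ∘ₗ v) = 1 := by
  have := algHom_comp_convMul_distrib φ (toConv u) (toConv v)
  rw [h] at this
  apply WithConv.ofConv_injective
  rw [← this, LinearMap.convOne_def, LinearMap.convOne_def]
  ext x
  simp

variable (k H A) in
/-- The convolution element `h ↦ 1 ⊗ h` of `Hom(H, A ⊗ H)`. -/
def convInclRight : WithConv (H →ₗ[k] A ⊗[k] H) :=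
  toConv ((Algebra.TensorProduct.includeRight : H →ₐ[k] A ⊗[k] H).toLinearMap ∘ₗ LinearMap.id)

variable (k H A) in
/-- The convolution element `h ↦ 1 ⊗ S(h)` of `Hom(H, A ⊗ H)`. -/
def convInclRightAntipode : WithConv (H →ₗ[k] A ⊗[k] H) :=
  toConv ((Algebra.TensorProduct.includeRight : H →ₐ[k] A ⊗[k] H).toLinearMap ∘ₗ
    HopfAlgebra.antipode k)

/-- The convolution element `h ↦ u(h) ⊗ 1` of `Hom(H, A ⊗ H)`. -/
def convInclLeft (u : H →ₗ[k] A) : WithConv (H →ₗ[k] A ⊗[k] H) :=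
  toConv ((Algebra.TensorProduct.includeLeft : A →ₐ[k] A ⊗[k] H).toLinearMap ∘ₗ u)

theorem convInclRight_mul_antipode :
    convInclRight k H A * convInclRightAntipode k H A = 1 :=
  algHom_comp_mul_eq_one _ id_mul_antipode

theorem convInclLeft_mul_eq_one {u v : H →ₗ[k] A} (h : toConv u * toConv v = 1) :
    convInclLeft u * convInclLeft v = 1 :=
  algHom_comp_mul_eq_one _ h

theorem IsTotalIntegral.toConv_comp {ρ : A →ₐ[k] A ⊗[k] H} {f : H →ₗ[k] A}
    (hf : IsTotalIntegral ρ f) :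
    toConv (ρ.toLinearMap ∘ₗ f) = convInclLeft f * convInclRight k H A := by
  rw [hf.colinear, LinearMap.convMul_def, ← LinearMap.comp_assoc]
  congr 2
  ext x y
  simp [convInclLeft, convInclRight]

/-- `ρ ∘ g` is a left inverse of `ρ ∘ f`, and the right-hand side is a right inverse because `f` is
colinear; the two must agree. -/
theorem toConv_comp_inverse {ρ : A →ₐ[k] A ⊗[k] H} {f g : H →ₗ[k] A}
    (hf : IsTotalIntegral ρ f) (hg : IsConvolutionInverse f g) :
    toConv (ρ.toLinearMap ∘ₗ g) = convInclRightAntipode k H A * convInclLeft g := by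
  refine left_inv_eq_right_inv (algHom_comp_mul_eq_one ρ hg.inv_mul) ?_
  rw [hf.toConv_comp, mul_assoc, ← mul_assoc (convInclRight k H A), convInclRight_mul_antipode,
    one_mul, convInclLeft_mul_eq_one hg.mul_inv]

/-- `ρ(g(h)) = g(h₍₂₎) ⊗ S(h₍₁₎)` for the convolution inverse `g` of a total integral. -/
theorem coaction_inverse {ρ : A →ₐ[k] A ⊗[k] H} {f g : H →ₗ[k] A}
    (hf : IsTotalIntegral ρ f) (hg : IsConvolutionInverse f g) (h : H) :
    ρ (g h) = TensorProduct.comm k H A (TensorProduct.map (HopfAlgebra.antipode k) g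
      (comul (R := k) h)) := by
  have := congr(($(toConv_comp_inverse hf hg)).ofConv h)
  refine this.trans ?_
  rw [LinearMap.convMul_def]
  simp only [LinearMap.comp_apply]
  induction comul (R := k) h using TensorProduct.induction_on with
  | zero => simp
  | tmul x y => simp [convInclRightAntipode, convInclLeft]
  | add x y hx hy => simp only [map_add, hx, hy]

/-- Colinearity of `f` gives `g(h₍₁₎) f(h₍₂₎) ⊗ h₍₃₎`, and the first factor cancels. -/
theorem preCan_map_comul {ρ : A →ₐ[k] A ⊗[k] H} {f g : H →ₗ[k] A}
    (hf : IsTotalIntegral ρ f) (hg : IsConvolutionInverse f g) (h : H) :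
    preCan ρ (TensorProduct.map g f (comul (R := k) h)) = 1 ⊗ₜ[k] h := by
  have key : convInclLeft g * toConv (ρ.toLinearMap ∘ₗ f) = convInclRight k H A := by
    rw [hf.toConv_comp, ← mul_assoc, convInclLeft_mul_eq_one hg.inv_mul, one_mul]
  have := congr(($key).ofConv h)
  refine Eq.trans ?_ this
  rw [LinearMap.convMul_def]
  simp only [LinearMap.comp_apply]
  induction comul (R := k) h using TensorProduct.induction_on with
  | zero => simp
  | tmul x y => simp [preCan_tmul, convInclLeft]
  | add x y hx hy => simp only [map_add, hx, hy]

/-- Rebrackets the fourfold coproduct so that the two middle legs are the coproduct of one leg: they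
will form the action of `h₍₂₎`, the outer legs the factors `S(h₍₁₎)` and `h₍₃₎`. -/
theorem map_comul_comul (h : H) :
    (TensorProduct.assoc k H H (H ⊗[k] H)).toLinearMap
        (TensorProduct.map (comul (R := k)) (comul (R := k)) (comul (R := k) h)) =
      ((TensorProduct.assoc k H H H).toLinearMap ∘ₗ (comul (R := k)).rTensor H).lTensor H
        ((comul (R := k)).lTensor H (comul (R := k) h)) := by
  have h1 : ((TensorProduct.assoc k H H H).toLinearMap ∘ₗ (comul (R := k)).rTensor H).lTensor H
        ((comul (R := k)).lTensor H (comul (R := k) h)) =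
      ((comul (R := k) (A := H)).lTensor H).lTensor H
        ((comul (R := k)).lTensor H (comul (R := k) h)) := by
    rw [← LinearMap.lTensor_comp_apply, ← LinearMap.lTensor_comp_apply, LinearMap.comp_assoc,
      Coalgebra.coassoc]
  rw [h1, ← Coalgebra.coassoc_apply]
  have h2 : TensorProduct.map (comul (R := k)) (comul (R := k)) (comul (R := k) h) =
      (comul (R := k) (A := H)).lTensor (H ⊗[k] H) ((comul (R := k)).rTensor H
        (comul (R := k) h)) := by
    rw [← LinearMap.lTensor_comp_rTensor, LinearMap.comp_apply]
  rw [h2]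
  induction (comul (R := k)).rTensor H (comul (R := k) h) using TensorProduct.induction_on with
  | zero => simp
  | add x y hx hy => simp only [map_add, hx, hy]
  | tmul x y =>
    induction x using TensorProduct.induction_on with
    | zero => simp
    | add x y hx hy => simp only [TensorProduct.add_tmul, map_add, hx, hy]
    | tmul x z => simp

end Convolution

/-! ### Sandwich operators and their dependence on the canonical map -/

section Sandwich

variable {k H A : Type*} [Field k] [Ring H] [HopfAlgebra k H] [Ring A] [Algebra k A]

variable (k A) in
/-- The linear map sending `l ⊗ r` to the operator `a ↦ r a l`. -/
def sandwich : A ⊗[k] A →ₗ[k] Module.End k A :=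
  TensorProduct.lift ((LinearMap.mul k (Module.End k A)).flip.compl₁₂
    (LinearMap.mul k A).flip (LinearMap.mul k A))

@[simp]
theorem sandwich_tmul (l r a : A) : sandwich k A (l ⊗ₜ r) a = r * (a * l) := by
  simp [sandwich]

theorem cleftAction_eq_sandwich (f g : H →ₗ[k] A) (h : H) (a : A) :
    cleftAction f g h a = sandwich k A (TensorProduct.map g f (comul (R := k) h)) a := by
  unfold cleftAction
  induction comul (R := k) h using TensorProduct.induction_on with
  | zero => simp
  | tmul x y => simp
  | add x y hx hy => simp only [map_add, hx, hy, LinearMap.add_apply]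

theorem sandwich_mul_right (t : A ⊗[k] A) (a b : A) :
    sandwich k A t (a * b) = sandwich k A (b ⊗ₜ 1 * t) a := by
  induction t using TensorProduct.induction_on with
  | zero => simp
  | tmul x y => simp [mul_assoc]
  | add x y hx hy => simp only [mul_add, map_add, hx, hy, LinearMap.add_apply]

theorem sandwich_mul_left (t : A ⊗[k] A) (a b : A) :
    sandwich k A t (b * a) = sandwich k A (t * 1 ⊗ₜ b) a := by
  induction t using TensorProduct.induction_on with
  | zero => simp
  | tmul x y => simp [mul_assoc]
  | add x y hx hy => simp only [add_mul, map_add, hx, hy, LinearMap.add_apply]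

theorem preCan_tmul_one_mul (ρ : A →ₐ[k] A ⊗[k] H) (t : A ⊗[k] A) (b : A) :
    preCan ρ (b ⊗ₜ 1 * t) = b ⊗ₜ 1 * preCan ρ t := by
  induction t using TensorProduct.induction_on with
  | zero => simp
  | tmul x y => simp [preCan_tmul, ← mul_assoc]
  | add x y hx hy => simp only [mul_add, map_add, hx, hy]

theorem preCan_mul_one_tmul (ρ : A →ₐ[k] A ⊗[k] H) (t : A ⊗[k] A) (b : A) :
    preCan ρ (t * 1 ⊗ₜ b) = preCan ρ t * ρ b := by
  induction t using TensorProduct.induction_on with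
  | zero => simp
  | tmul x y => simp [preCan_tmul, mul_assoc]
  | add x y hx hy => simp only [add_mul, map_add, hx, hy]

/-- The relation `lb ⊗ r - l ⊗ br` sends `a` to the commutator of `r a l` with `b`. -/
theorem mkQ_sandwich_eq_zero (B : Subalgebra k A) (a : A) {t : A ⊗[k] A}
    (ht : t ∈ balancingRelations B) : (commutatorSubspace B).mkQ (sandwich k A t a) = 0 := by
  suffices h : balancingRelations B ≤
      LinearMap.ker ((commutatorSubspace B).mkQ ∘ₗ (sandwich k A).flip a) from h ht
  refine Submodule.span_le.2 ?_
  rintro _ ⟨l, r, b, hb, rfl⟩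
  rw [SetLike.mem_coe, LinearMap.mem_ker, LinearMap.comp_apply, Submodule.mkQ_apply,
    Submodule.Quotient.mk_eq_zero]
  refine Submodule.subset_span ⟨r * (a * l), b, hb, ?_⟩
  simp [mul_assoc]

theorem mkQ_sandwich_congr {ρ : A →ₐ[k] A ⊗[k] H} (hρ : Function.Injective (can ρ)) (a : A)
    {t t' : A ⊗[k] A} (h : preCan ρ t = preCan ρ t') :
    (commutatorSubspace (coinvariants ρ)).mkQ (sandwich k A t a) =
      (commutatorSubspace (coinvariants ρ)).mkQ (sandwich k A t' a) := by
  have : t - t' ∈ balancingRelations (coinvariants ρ) :=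
    (Submodule.Quotient.eq _).1 (hρ h)
  simpa [sub_eq_zero] using mkQ_sandwich_eq_zero _ a this

/-- The composite of the operators of two lifts of `1 ⊗ x` and `1 ⊗ y` along `preCan ρ` is the
operator of a lift of `1 ⊗ xy`. -/
theorem exists_sandwich_mul (ρ : A →ₐ[k] A ⊗[k] H) (s t : A ⊗[k] A) {x y : H}
    (hs : preCan ρ s = 1 ⊗ₜ x) (ht : preCan ρ t = 1 ⊗ₜ y) :
    ∃ u, preCan ρ u = 1 ⊗ₜ (x * y) ∧ sandwich k A u = sandwich k A s * sandwich k A t := by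
  have key : ∀ t : A ⊗[k] A, ∃ u, preCan ρ u = 1 ⊗ₜ x * preCan ρ t ∧
      sandwich k A u = sandwich k A s * sandwich k A t := by
    intro t
    induction t using TensorProduct.induction_on with
    | zero => exact ⟨0, by simp, by simp⟩
    | tmul l r =>
      -- Applying `s` to `r a l` absorbs `l` and `r` into the outer ends of `s`. On images, `l ⊗ 1`
      -- commutes past `1 ⊗ x`.
      refine ⟨l ⊗ₜ 1 * (s * 1 ⊗ₜ r), ?_, ?_⟩
      · rw [preCan_tmul_one_mul, preCan_mul_one_tmul, hs, preCan_tmul, ← mul_assoc, ← mul_assoc]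
        simp
      · ext a
        rw [Module.End.mul_apply, sandwich_tmul, sandwich_mul_left, sandwich_mul_right]
    | add t t' h h' =>
      obtain ⟨u, hu, hu'⟩ := h
      obtain ⟨v, hv, hv'⟩ := h'
      exact ⟨u + v, by simp only [map_add, hu, hv, mul_add],
        by simp only [map_add, hu', hv', mul_add]⟩
  obtain ⟨u, hu, hu'⟩ := key t
  exact ⟨u, by rw [hu, ht]; simp, hu'⟩

end Sandwich

/-! ### The action on `A_B` -/

section Structure

variable {k H A : Type*} [Field k] [Ring H] [HopfAlgebra k H] [Ring A] [Algebra k A]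
  {ρ : A →ₐ[k] A ⊗[k] H} {f g : H →ₗ[k] A}

/-- Absorbing `b` into `t` on either side gives elements with the same image, since `ρ b = b ⊗ 1`
commutes with `1 ⊗ h`. -/
theorem mkQ_sandwich_commutator (hρ : Function.Injective (can ρ)) {h : H} {t : A ⊗[k] A}
    (ht : preCan ρ t = 1 ⊗ₜ h) (a : A) {b : A} (hb : b ∈ coinvariants ρ) :
    (commutatorSubspace (coinvariants ρ)).mkQ (sandwich k A t (a * b)) =
      (commutatorSubspace (coinvariants ρ)).mkQ (sandwich k A t (b * a)) := by
  rw [sandwich_mul_right, sandwich_mul_left]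
  refine mkQ_sandwich_congr hρ a ?_
  rw [preCan_tmul_one_mul, preCan_mul_one_tmul, ht, (mem_coinvariants ρ b).1 hb]
  simp

theorem le_ker_mkQ_sandwich (hρ : Function.Injective (can ρ)) (hf : IsTotalIntegral ρ f)
    (hg : IsConvolutionInverse f g) :
    commutatorSubspace (coinvariants ρ) ≤ LinearMap.ker
      (LinearMap.compRight k (M := A) (commutatorSubspace (coinvariants ρ)).mkQ ∘ₗ sandwich k A ∘ₗ
        TensorProduct.map g f ∘ₗ comul (R := k)).flip := by
  refine Submodule.span_le.2 ?_
  rintro _ ⟨a, b, hb, rfl⟩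
  rw [SetLike.mem_coe, LinearMap.mem_ker]
  ext h
  simpa [sub_eq_zero] using
    mkQ_sandwich_commutator hρ (preCan_map_comul hf hg h) a hb

/-- The linear map `H → End(A_B)` given by `h · ā = [f(h₍₂₎) a g(h₍₁₎)]`. -/
def miyashitaUlbrichMap (hρ : Function.Injective (can ρ)) (hf : IsTotalIntegral ρ f)
    (hg : IsConvolutionInverse f g) :
    H →ₗ[k] Module.End k (CommutatorQuotient (coinvariants ρ)) :=
  ((commutatorSubspace (coinvariants ρ)).liftQ _ (le_ker_mkQ_sandwich hρ hf hg)).flip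

theorem miyashitaUlbrichMap_mkQ (hρ : Function.Injective (can ρ)) (hf : IsTotalIntegral ρ f)
    (hg : IsConvolutionInverse f g) (h : H) (a : A) :
    miyashitaUlbrichMap hρ hf hg h ((commutatorSubspace (coinvariants ρ)).mkQ a) =
      (commutatorSubspace (coinvariants ρ)).mkQ
        (sandwich k A (TensorProduct.map g f (comul (R := k) h)) a) := rfl

/-- The left `H`-action `h · ā = [f(h₍₂₎) a g(h₍₁₎)]` on `A_B`. -/
def miyashitaUlbrich (hρ : Function.Injective (can ρ)) (hf : IsTotalIntegral ρ f)
    (hg : IsConvolutionInverse f g) :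
    H →ₐ[k] Module.End k (CommutatorQuotient (coinvariants ρ)) :=
  AlgHom.ofLinearMap (miyashitaUlbrichMap hρ hf hg)
    (by
      refine LinearMap.ext fun m => ?_
      obtain ⟨a, rfl⟩ := Submodule.mkQ_surjective _ m
      -- `1 ⊗ 1` is another lift of the unit of `A ⊗ H`, and its operator is the identity.
      rw [miyashitaUlbrichMap_mkQ, mkQ_sandwich_congr hρ a (t' := 1 ⊗ₜ 1)]
      · simp
      · rw [preCan_map_comul hf hg, preCan_tmul]
        simp [Algebra.TensorProduct.one_def])
    (by
      intro x y
      refine LinearMap.ext fun m => ?_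
      obtain ⟨a, rfl⟩ := Submodule.mkQ_surjective _ m
      obtain ⟨u, hu, hu'⟩ := exists_sandwich_mul ρ _ _ (preCan_map_comul hf hg x)
        (preCan_map_comul hf hg y)
      rw [miyashitaUlbrichMap_mkQ, mkQ_sandwich_congr hρ a (t' := u), hu',
        Module.End.mul_apply, Module.End.mul_apply, miyashitaUlbrichMap_mkQ,
        miyashitaUlbrichMap_mkQ]
      rw [preCan_map_comul hf hg, hu])

theorem miyashitaUlbrich_mkQ (hρ : Function.Injective (can ρ)) (hf : IsTotalIntegral ρ f)
    (hg : IsConvolutionInverse f g) (h : H) (a : A) :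
    miyashitaUlbrich hρ hf hg h ((commutatorSubspace (coinvariants ρ)).mkQ a) =
      (commutatorSubspace (coinvariants ρ)).mkQ
        (sandwich k A (TensorProduct.map g f (comul (R := k) h)) a) := rfl

/-! ### The coaction on `A_B` -/

theorem rTensor_mkQ_commutator (B : Subalgebra k A) (t : A ⊗[k] H) {b : A} (hb : b ∈ B) :
    (commutatorSubspace B).mkQ.rTensor H (t * b ⊗ₜ 1) =
      (commutatorSubspace B).mkQ.rTensor H (b ⊗ₜ 1 * t) := by
  induction t using TensorProduct.induction_on with
  | zero => simp
  | tmul a h =>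
    have : (commutatorSubspace B).mkQ (a * b) = (commutatorSubspace B).mkQ (b * a) :=
      (Submodule.Quotient.eq _).2 (Submodule.subset_span ⟨a, b, hb, rfl⟩)
    simp only [Algebra.TensorProduct.tmul_mul_tmul, LinearMap.rTensor_tmul, this, mul_one, one_mul]
  | add x y hx hy => simp only [mul_add, add_mul, map_add, hx, hy]

variable (ρ) in
theorem le_ker_rTensor_mkQ_comp :
    commutatorSubspace (coinvariants ρ) ≤ LinearMap.ker
      ((commutatorSubspace (coinvariants ρ)).mkQ.rTensor H ∘ₗ ρ.toLinearMap) := by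
  refine Submodule.span_le.2 ?_
  rintro _ ⟨a, b, hb, rfl⟩
  have := rTensor_mkQ_commutator (coinvariants ρ) (ρ a) hb
  rw [SetLike.mem_coe, LinearMap.mem_ker, LinearMap.comp_apply, AlgHom.toLinearMap_apply, map_sub,
    map_mul, map_mul, (mem_coinvariants ρ b).1 hb, map_sub, this, sub_self]

variable (ρ) in
/-- The coaction `ā ↦ [a₍₀₎] ⊗ a₍₁₎` on `A_B`. -/
def quotientCoaction : CommutatorQuotient (coinvariants ρ) →ₗ[k]
    CommutatorQuotient (coinvariants ρ) ⊗[k] H :=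
  (commutatorSubspace (coinvariants ρ)).liftQ _ (le_ker_rTensor_mkQ_comp ρ)

variable (ρ) in
theorem quotientCoaction_mkQ (a : A) :
    quotientCoaction ρ ((commutatorSubspace (coinvariants ρ)).mkQ a) =
      (commutatorSubspace (coinvariants ρ)).mkQ.rTensor H (ρ a) := rfl

theorem IsRightCoaction.of_surjective {M N : Type*} [AddCommGroup M] [Module k M]
    [AddCommGroup N] [Module k N] {δ : M →ₗ[k] M ⊗[k] H} {δ' : N →ₗ[k] N ⊗[k] H}
    (hδ : IsRightCoaction δ) (p : M →ₗ[k] N) (hp : Function.Surjective p)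
    (h : ∀ m, δ' (p m) = p.rTensor H (δ m)) : IsRightCoaction δ' where
  coassoc := by
    refine LinearMap.ext fun n => ?_
    obtain ⟨m, rfl⟩ := hp n
    have h1 := congr(p.rTensor (H ⊗[k] H) ($(hδ.coassoc) m))
    simp only [LinearMap.comp_apply, LinearEquiv.coe_coe] at h1 ⊢
    rw [h]
    calc _ = p.rTensor (H ⊗[k] H) (TensorProduct.assoc k M H H (δ.rTensor H (δ m))) := by
          induction δ m using TensorProduct.induction_on with
          | zero => simp
          | add x y hx hy => simp only [map_add, hx, hy]
          | tmul x y =>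
            simp only [LinearMap.rTensor_tmul, h]
            induction δ x using TensorProduct.induction_on with
            | zero => simp
            | add x y hx hy => simp only [TensorProduct.add_tmul, map_add, hx, hy]
            | tmul x z => simp
      _ = _ := by
          rw [h1]
          rw [← LinearMap.comp_apply, LinearMap.rTensor_comp_lTensor,
            ← LinearMap.lTensor_comp_rTensor, LinearMap.comp_apply]
  counit := by
    refine LinearMap.ext fun n => ?_
    obtain ⟨m, rfl⟩ := hp n
    have h1 := congr(p ($(hδ.counit) m))
    simp only [LinearMap.comp_apply, LinearEquiv.coe_coe, LinearMap.id_apply] at h1 ⊢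
    rw [h]
    refine Eq.trans ?_ h1
    induction δ m using TensorProduct.induction_on with
    | zero => simp
    | add x y hx hy => simp only [map_add, hx, hy]
    | tmul x y => simp

/-! ### The anti Yetter-Drinfeld condition and stability -/

theorem algHom_sandwich {D : Type*} [Ring D] [Algebra k D] (φ : A →ₐ[k] D) (t : A ⊗[k] A)
    (a : A) : φ (sandwich k A t a) =
      sandwich k D (TensorProduct.map φ.toLinearMap φ.toLinearMap t) (φ a) := by
  induction t using TensorProduct.induction_on with
  | zero => simp
  | tmul x y => simp
  | add x y hx hy => simp only [map_add, hx, hy, LinearMap.add_apply]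

theorem map_coaction_map_comul (hf : IsTotalIntegral ρ f) (hg : IsConvolutionInverse f g) (h : H) :
    TensorProduct.map ρ.toLinearMap ρ.toLinearMap
        (TensorProduct.map g f (comul (R := k) h)) =
      TensorProduct.map ((TensorProduct.comm k H A).toLinearMap ∘ₗ
          TensorProduct.map (HopfAlgebra.antipode k) g) (f.rTensor H)
        (TensorProduct.map (comul (R := k)) (comul (R := k)) (comul (R := k) h)) := by
  induction comul (R := k) h using TensorProduct.induction_on with
  | zero => simp
  | tmul x y =>
    have h1 : ρ (f y) = f.rTensor H (comul (R := k) y) := congr($(hf.colinear) y)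
    simp [coaction_inverse hf hg, h1]
  | add x y hx hy => simp only [map_add, hx, hy]

/-- For `z = x ⊗ y ⊗ w` and `t = m ⊗ s` both sides are the class of `f(y₍₂₎) m g(y₍₁₎) ⊗ w s S(x)`.
Letting `z` and `t` be arbitrary tensors makes induction possible. -/
theorem rTensor_mkQ_sandwich_eq_aydOperator (hρ : Function.Injective (can ρ))
    (hf : IsTotalIntegral ρ f) (hg : IsConvolutionInverse f g) (z : H ⊗[k] (H ⊗[k] H))
    (t : A ⊗[k] H) :
    (commutatorSubspace (coinvariants ρ)).mkQ.rTensor H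
        (sandwich k (A ⊗[k] H) (TensorProduct.map ((TensorProduct.comm k H A).toLinearMap ∘ₗ
          TensorProduct.map (HopfAlgebra.antipode k) g) (f.rTensor H)
          ((TensorProduct.assoc k H H (H ⊗[k] H)).symm
            (((TensorProduct.assoc k H H H).toLinearMap ∘ₗ
              (comul (R := k)).rTensor H).lTensor H z))) t) =
      aydOperator (miyashitaUlbrich hρ hf hg) z
        ((commutatorSubspace (coinvariants ρ)).mkQ.rTensor H t) := by
  induction z using TensorProduct.induction_on with
  | zero => simp
  | add x y hx hy => simp only [map_add, hx, hy, LinearMap.add_apply]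
  | tmul x z =>
  induction z using TensorProduct.induction_on with
  | zero => simp
  | add y y' hy hy' => simp only [TensorProduct.tmul_add, map_add, hy, hy', LinearMap.add_apply]
  | tmul y w =>
  induction t using TensorProduct.induction_on with
  | zero => simp
  | add y y' hy hy' => simp only [map_add, hy, hy']
  | tmul m t =>
  rw [LinearMap.rTensor_tmul, aydOperator_tmul, miyashitaUlbrich_mkQ, LinearMap.lTensor_tmul,
    LinearMap.comp_apply, LinearMap.rTensor_tmul, LinearEquiv.coe_coe]
  induction comul (R := k) y using TensorProduct.induction_on with
  | zero => simp
  | add y y' hy hy' =>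
    simp only [TensorProduct.tmul_add, TensorProduct.add_tmul, map_add, hy, hy',
      LinearMap.add_apply]
  | tmul y y' => simp [mul_assoc]

theorem rTensor_mkQ_coaction_sandwich (hρ : Function.Injective (can ρ))
    (hf : IsTotalIntegral ρ f) (hg : IsConvolutionInverse f g) (h : H) (a : A) :
    (commutatorSubspace (coinvariants ρ)).mkQ.rTensor H
        (ρ (sandwich k A (TensorProduct.map g f (comul (R := k) h)) a)) =
      aydOperator (miyashitaUlbrich hρ hf hg)
        ((comul (R := k) (A := H)).lTensor H (comul (R := k) h))
        ((commutatorSubspace (coinvariants ρ)).mkQ.rTensor H (ρ a)) := by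
  rw [algHom_sandwich, map_coaction_map_comul hf hg,
    ← rTensor_mkQ_sandwich_eq_aydOperator hρ hf hg, ← map_comul_comul, LinearEquiv.coe_coe,
    LinearEquiv.symm_apply_apply]

/-- Acting by the second leg of a tensor on the class of its first amounts to evaluating at `1` the
operator of any lift of that tensor; `1 ⊗ a` is a lift of `ρ a`, with value `a`. -/
theorem lift_flip_rTensor_mkQ (hρ : Function.Injective (can ρ))
    (hf : IsTotalIntegral ρ f) (hg : IsConvolutionInverse f g) (a : A) :
    TensorProduct.lift (miyashitaUlbrich hρ hf hg).toLinearMap.flip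
        ((commutatorSubspace (coinvariants ρ)).mkQ.rTensor H (ρ a)) =
      (commutatorSubspace (coinvariants ρ)).mkQ a := by
  have key : ∀ t : A ⊗[k] H, ∃ u : A ⊗[k] A, preCan ρ u = t ∧
      TensorProduct.lift (miyashitaUlbrich hρ hf hg).toLinearMap.flip
        ((commutatorSubspace (coinvariants ρ)).mkQ.rTensor H t) =
      (commutatorSubspace (coinvariants ρ)).mkQ (sandwich k A u 1) := by
    intro t
    induction t using TensorProduct.induction_on with
    | zero => exact ⟨0, by simp, by simp⟩
    | tmul m h =>
      -- This lift of `m ⊗ h` has value `f(h₍₂₎) m g(h₍₁₎)` at `1`.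
      refine ⟨m ⊗ₜ 1 * TensorProduct.map g f (comul (R := k) h), ?_, ?_⟩
      · rw [preCan_tmul_one_mul, preCan_map_comul hf hg]
        simp
      · rw [← sandwich_mul_right, one_mul, LinearMap.rTensor_tmul, TensorProduct.lift.tmul]
        rfl
    | add t t' h h' =>
      obtain ⟨u, hu, hu'⟩ := h
      obtain ⟨v, hv, hv'⟩ := h'
      exact ⟨u + v, by simp only [map_add, hu, hv],
        by simp only [map_add, hu', hv', LinearMap.add_apply]⟩
  obtain ⟨u, hu, hu'⟩ := key (ρ a)
  rw [hu', mkQ_sandwich_congr hρ 1 (t' := 1 ⊗ₜ a)]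
  · simp
  · rw [hu, preCan_tmul, ← Algebra.TensorProduct.one_def, one_mul]

end Structure

end HopfGalois

theorem proposition3p12 {k H A : Type*} [Field k] [Ring H] [HopfAlgebra k H]
    [Ring A] [Algebra k A]
    (hS : Function.Bijective (HopfAlgebra.antipode k : H →ₗ[k] H))
    (ρ : A →ₐ[k] A ⊗[k] H) (hρ : HopfGalois.IsHopfGaloisExtension ρ)
    (f finv : H →ₗ[k] A) (hf : HopfGalois.IsTotalIntegral ρ f)
    (hfinv : HopfGalois.IsConvolutionInverse f finv) :
    ∃ (act : H →ₐ[k] Module.End k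
        (HopfGalois.CommutatorQuotient (HopfGalois.coinvariants ρ)))
      (ρB : HopfGalois.CommutatorQuotient (HopfGalois.coinvariants ρ) →ₗ[k]
        HopfGalois.CommutatorQuotient (HopfGalois.coinvariants ρ) ⊗[k] H),
      (∀ (h : H) (a : A),
        act h ((HopfGalois.commutatorSubspace (HopfGalois.coinvariants ρ)).mkQ a) =
          (HopfGalois.commutatorSubspace (HopfGalois.coinvariants ρ)).mkQ
            (HopfGalois.cleftAction f finv h a)) ∧
      (∀ a : A,
        ρB ((HopfGalois.commutatorSubspace (HopfGalois.coinvariants ρ)).mkQ a) =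
          (HopfGalois.commutatorSubspace (HopfGalois.coinvariants ρ)).mkQ.rTensor H (ρ a)) ∧
      HopfGalois.IsLeftRightSAYD act ρB := by
  refine ⟨HopfGalois.miyashitaUlbrich hρ.can_bijective.1 hf hfinv, HopfGalois.quotientCoaction ρ,
    fun h a => ?_, fun a => rfl, ?_, fun h m => ?_, fun m => ?_⟩
  · rw [HopfGalois.miyashitaUlbrich_mkQ, HopfGalois.cleftAction_eq_sandwich]
  · exact hρ.coaction.of_surjective _ (Submodule.mkQ_surjective _) fun a => rfl
  · obtain ⟨a, rfl⟩ := Submodule.mkQ_surjective _ m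
    rw [HopfGalois.miyashitaUlbrich_mkQ, HopfGalois.quotientCoaction_mkQ,
      HopfGalois.quotientCoaction_mkQ, HopfGalois.rTensor_mkQ_coaction_sandwich]
  · obtain ⟨a, rfl⟩ := Submodule.mkQ_surjective _ m
    rw [HopfGalois.quotientCoaction_mkQ, HopfGalois.lift_flip_rTensor_mkQ]
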